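/- Let $n\ge 0$. For an $n\times n$ complex matrix $A$ and index sets $I,J\subset\{1,\dots,n\}$ with $|I|=|J|$ let $\Delta^I_J(A)$ be the minor with rows $I$ and columns $J$, and $\Delta_I=\Delta^I_I$; index sets are also written as binary multi-indices $I\in\{0,1\}^n$. The exclusive rank (E-rank) of $A$ is the least $k\ge 0$ such that $\Delta^I_J(A)=0$ for all disjoint $I,J$ with $|I|=|J|=k+1$. Let $X\subset S^2\mathbb C^n$ be the set of symmetric matrices of E-rank at most one. Let $\varphi:\mathbb P(S^2\mathbb C^n\oplus\mathbb C)\dashrightarrow\mathbb P\big((\mathbb C^2)^{\otimes n}\big)=\mathbb P\mathbb C^{2^n}$ be the rational map $[A,t]\mapsto[\,t^{n-|I|}\Delta_I(A)\,X^I\,]$ $(t\ne 0)$, where $X^I=x^{i_1}\otimes\dots\otimes x^{i_n}$ for a basis $x^0,x^1$ of $\mathbb C^2$, and let $\varphi(X)$ be the Zariski closure of $\{\varphi([A,t]) : A\in X,\ t\neq 0\}$. Let $G=SL(2,\mathbb C)^{\times n}\rtimes\mathfrak S_n$, where $\mathfrak S_n$ permutes the factors, $(\sigma\cdot g)_i=g_{\sigma^{-1}(i)}$.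 It acts on $(\mathbb C^2)^{\otimes n}$, $SL(2)^{\times n}$ acting factor by factor and $\mathfrak S_n$ permuting the factors. Let $\iota:G\to Sp(2n,\mathbb C)$ send $(g,\sigma)$, with $g_i=\begin{pmatrix}a_i&b_i\\c_i&d_i\end{pmatrix}$, to $$\begin{pmatrix}\operatorname{diag}(a_i)&\operatorname{diag}(b_i)\\ \operatorname{diag}(c_i)&\operatorname{diag}(d_i)\end{pmatrix}\begin{pmatrix}P_\sigma&0\\0&P_\sigma\end{pmatrix},$$ where $P_\sigma e_j=e_{\sigma(j)}$. Then: 1. $X$ is a Zariski-closed, irreducible affine variety, and if $n\ge 3$ then $\dim X=2n$ (the transcendence degree over $\mathbb C$ of its function field). 2. $X$ is parametrized by diagonal matrices plus symmetric matrices of rank at most one: $X$ is the Zariski closure of the image of $\mathbb C^n\times\mathbb C^n\to S^2\mathbb C^n$, $(d,y)\mapsto\operatorname{diag}(d)+y\,{}^t y$. 3. The homomorphism $\iota$ is injective, so that $G\subset Sp(2n)$, and the action of $G$ on $\mathbb P\mathbb C^{2^n}$ is the one induced by the action of $Sp(2n)$ on Lagrangian subspaces: if $\iota(g)=\begin{pmatrix}P&Q\\R&S\end{pmatrix}$,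 $A$ is symmetric and $P+QA$ is invertible, then $B=(R+SA)(P+QA)^{-1}$ is symmetric and $\varphi([B,1])=g\cdot\varphi([A,1])$. 4. $\varphi(X)$ is a Zariski-closed, irreducible projective variety with $g\cdot\varphi(X)=\varphi(X)$ for all $g\in G$. -/

import Mathlib

open scoped Topology Matrix LinearAlgebra.Projectivization

noncomputable section

/-! ## Zariski topologies over the complex numbers -/

/-- The Zariski topology on the affine space `ℂ^σ`: the closed sets are the common zero sets of
sets of polynomials. -/
@[reducible] def affineZariski (σ : Type) : TopologicalSpace (σ → ℂ) :=
  TopologicalSpace.ofClosed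
    {Z | ∃ T : Set (MvPolynomial σ ℂ), Z = {x | ∀ f ∈ T, MvPolynomial.eval x f = 0}}
    ⟨{1}, by ext x; simp⟩
    (by
      intro A hA
      refine ⟨{f | ∃ Z ∈ A, ∀ x ∈ Z, MvPolynomial.eval x f = 0}, ?_⟩
      ext x
      constructor
      · rintro hx f ⟨Z, hZ, hf⟩
        exact hf x (hx Z hZ)
      · intro hx Z hZ
        obtain ⟨T, rfl⟩ := hA hZ
        exact fun f hf => hx f ⟨_, hZ, fun y hy => hy f hf⟩)
    (by
      rintro _ ⟨S, rfl⟩ _ ⟨T, rfl⟩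
      refine ⟨{h | ∃ f ∈ S, ∃ g ∈ T, h = f * g}, ?_⟩
      ext x
      constructor
      · rintro (hx | hx) _ ⟨f, hf, g, hg, rfl⟩
        · simp [hx f hf]
        · simp [hx g hg]
      · intro hx
        by_contra hcon
        simp only [Set.mem_union, Set.mem_ofPred_eq, not_or, not_forall] at hcon
        obtain ⟨⟨f, hf, hfx⟩, ⟨g, hg, hgx⟩⟩ := hcon
        have := hx _ ⟨f, hf, g, hg, rfl⟩
        rw [map_mul] at this
        exact (mul_ne_zero hfx hgx) this)

/-- The Zariski topology on the projective space `ℙ(ℂ^σ)`: the closed sets are the common zero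
sets of sets of homogeneous polynomials. -/
@[reducible] def projectiveZariski (σ : Type) : TopologicalSpace (ℙ ℂ (σ → ℂ)) :=
  TopologicalSpace.ofClosed
    {Z | ∃ T : Set (MvPolynomial σ ℂ), (∀ f ∈ T, ∃ d, f.IsHomogeneous d) ∧
      Z = {p | ∀ f ∈ T, MvPolynomial.eval p.rep f = 0}}
    ⟨{1}, by
      simp only [Set.mem_singleton_iff, forall_eq]
      exact ⟨⟨0, MvPolynomial.isHomogeneous_one _ _⟩, by ext x; simp⟩⟩
    (by
      intro A hA
      refine ⟨{f | (∃ d, f.IsHomogeneous d) ∧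
        ∃ Z ∈ A, ∀ p ∈ Z, MvPolynomial.eval p.rep f = 0}, fun f hf => hf.1, ?_⟩
      ext x
      constructor
      · rintro hx f ⟨-, Z, hZ, hf⟩
        exact hf x (hx Z hZ)
      · intro hx Z hZ
        obtain ⟨T, hT, rfl⟩ := hA hZ
        exact fun f hf => hx f ⟨hT f hf, _, hZ, fun y hy => hy f hf⟩)
    (by
      rintro _ ⟨S, hS, rfl⟩ _ ⟨T, hT, rfl⟩
      refine ⟨{h | ∃ f ∈ S, ∃ g ∈ T, h = f * g}, ?_, ?_⟩
      · rintro _ ⟨f, hf, g, hg, rfl⟩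
        obtain ⟨d, hd⟩ := hS f hf
        obtain ⟨e, he⟩ := hT g hg
        exact ⟨d + e, hd.mul he⟩
      ext x
      constructor
      · rintro (hx | hx) _ ⟨f, hf, g, hg, rfl⟩
        · simp [hx f hf]
        · simp [hx g hg]
      · intro hx
        by_contra hcon
        simp only [Set.mem_union, Set.mem_ofPred_eq, not_or, not_forall] at hcon
        obtain ⟨⟨f, hf, hfx⟩, ⟨g, hg, hgx⟩⟩ := hcon
        have := hx _ ⟨f, hf, g, hg, rfl⟩
        rw [map_mul] at this
        exact (mul_ne_zero hfx hgx) this)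

/-- The coordinate ring of a subset of affine space. -/
abbrev CoordinateRing {σ : Type} (Z : Set (σ → ℂ)) : Type :=
  MvPolynomial σ ℂ ⧸ MvPolynomial.vanishingIdeal ℂ Z

/-- The dimension of an irreducible affine variety: the transcendence degree over `ℂ` of its
function field, the fraction field of its coordinate ring. -/
def varietyDim {σ : Type} (Z : Set (σ → ℂ)) : Cardinal :=
  Algebra.trdeg ℂ (FractionRing (CoordinateRing Z))

/-! ## Minors, exclusive rank and the variety `X` -/

/-- The minor `Δ^I_J(A)` with rows `I` and columns `J`, both in increasing order. -/
def minor {n : ℕ} (A : Matrix (Fin n) (Fin n) ℂ) (I J : Finset (Fin n)) (h : I.card = J.card) :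
    ℂ :=
  (A.submatrix (I.orderEmbOfFin rfl) (J.orderEmbOfFin h.symm)).det

/-- The exclusive rank of `A`: the least `k` such that all `(k+1) × (k+1)` minors of `A` with
disjoint row and column sets vanish. -/
def exclusiveRank {n : ℕ} (A : Matrix (Fin n) (Fin n) ℂ) : ℕ :=
  sInf {k | ∀ (I J : Finset (Fin n)) (h : I.card = J.card),
    I.card = k + 1 → Disjoint I J → minor A I J h = 0}

/-- The entries of a matrix as a point of affine space. -/
def matrixPoint {n : ℕ} (A : Matrix (Fin n) (Fin n) ℂ) : Fin n × Fin n → ℂ := fun p => A p.1 p.2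

/-- The symmetric `n × n` matrices of exclusive rank at most one. -/
def exclusiveRankLEOne (n : ℕ) : Set (Matrix (Fin n) (Fin n) ℂ) :=
  {A | A.IsSymm ∧ exclusiveRank A ≤ 1}

/-! ## The principal minor map -/

/-- Coordinates of the tensor product of `n` copies of `ℂ²` in the standard basis `X^I`, indexed
by binary multi-indices `I`. -/
abbrev TensorSpace (n : ℕ) : Type := (Fin n → Fin 2) → ℂ

/-- The subset of `{1, …, n}` given by a binary multi-index. -/
def multiSupport {n : ℕ} (I : Fin n → Fin 2) : Finset (Fin n) := Finset.univ.filter fun i => I i = 1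

/-- The vector with coordinates `t^(n-|I|) Δ_I(A)`. Here `|I| ≤ n`. -/
def principalMinorVector {n : ℕ} (A : Matrix (Fin n) (Fin n) ℂ) (t : ℂ) : TensorSpace n :=
  fun I => t ^ (n - (multiSupport I).card) * minor A (multiSupport I) (multiSupport I) rfl

theorem principalMinorVector_ne_zero {n : ℕ} (A : Matrix (Fin n) (Fin n) ℂ) {t : ℂ} (ht : t ≠ 0) :
    principalMinorVector A t ≠ 0 := by
  intro h
  have h0 := congrFun h (fun _ => 0)
  have hs : multiSupport (fun _ : Fin n => (0 : Fin 2)) = ∅ := by simp [multiSupport]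
  have : IsEmpty (Fin (multiSupport (fun _ : Fin n => (0 : Fin 2))).card) := by
    rw [hs, Finset.card_empty]; infer_instance
  simp only [principalMinorVector, minor, Pi.zero_apply] at h0
  rw [Matrix.det_isEmpty, mul_one] at h0
  exact pow_ne_zero _ ht h0

/-- The principal minor map `φ([A, t]) = [t^(n-|I|) Δ_I(A) X^I]`, for `t ≠ 0`. -/
def principalMinorMap {n : ℕ} (A : Matrix (Fin n) (Fin n) ℂ) (t : ℂ) (ht : t ≠ 0) :
    ℙ ℂ (TensorSpace n) :=
  Projectivization.mk ℂ (principalMinorVector A t) (principalMinorVector_ne_zero A ht)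

/-- The image of `X` under the rational map `φ`, that is, the Zariski closure of the set of
all `φ([A, t])` with `A ∈ X` and `t ≠ 0`. -/
def principalMinorImage {n : ℕ} (X : Set (Matrix (Fin n) (Fin n) ℂ)) :
    Set (ℙ ℂ (TensorSpace n)) :=
  closure[projectiveZariski (Fin n → Fin 2)]
    {p | ∃ A ∈ X, ∃ (t : ℂ) (ht : t ≠ 0), p = principalMinorMap A t ht}

/-! ## The group `SL(2)^n ⋊ S_n` -/

/-- `SL(2, ℂ)`. -/
abbrev SL2 : Type := Matrix.SpecialLinearGroup (Fin 2) ℂ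

/-- `SL(2)^n ⋊ S_n`, where permutations permute the factors: `(σ • g) i = g (σ⁻¹ i)`. -/
abbrev SegreGroup (n : ℕ) : Type :=
  (Fin n → SL2) ⋊[mulAutArrow (G := Equiv.Perm (Fin n)) (A := Fin n) (M := SL2)]
    Equiv.Perm (Fin n)

theorem SegreGroup.mul_left_apply {n : ℕ} (g h : SegreGroup n) (i : Fin n) :
    (g * h).left i = g.left i * h.left (g.right⁻¹ i) := rfl

/-- The `n × n` block of `(g, σ)` in position `(r, s)`: the diagonal matrix of the `(r, s)`
entries of the `g i`, times the permutation matrix sending `e_j` to `e_(σ j)`. -/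
def segreBlock {n : ℕ} (g : SegreGroup n) (r s : Fin 2) : Matrix (Fin n) (Fin n) ℂ :=
  fun i j => if i = g.right j then (g.left i).1 r s else 0

theorem segreBlock_mul {n : ℕ} (g h : SegreGroup n) (r s : Fin 2) :
    segreBlock (g * h) r s =
      segreBlock g r 0 * segreBlock h 0 s + segreBlock g r 1 * segreBlock h 1 s := by
  ext i k
  have key : ∀ q : Fin 2, (segreBlock g r q * segreBlock h q s) i k =
      if i = g.right (h.right k) then (g.left i).1 r q * (h.left (g.right⁻¹ i)).1 q s else 0 := by
    intro q
    rw [Matrix.mul_apply, Finset.sum_eq_single (g.right⁻¹ i)]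
    · by_cases hik : i = g.right (h.right k)
      · subst hik; simp [segreBlock]
      · have : ¬ g.right⁻¹ i = h.right k := fun hc => hik (by rw [← hc]; simp)
        rw [if_neg hik, segreBlock, segreBlock, if_neg this, mul_zero]
    · intro j _ hj
      have : ¬ i = g.right j := fun hc => hj (by rw [hc]; simp)
      simp [segreBlock, this]
    · simp
  rw [Matrix.add_apply, key, key]
  by_cases hik : i = g.right (h.right k)
  · have : i = (g * h).right k := hik
    rw [if_pos hik, if_pos hik, segreBlock, if_pos this, SegreGroup.mul_left_apply]
    simp [Matrix.mul_apply, Fin.sum_univ_two]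
  · have : ¬ i = (g * h).right k := hik
    rw [if_neg hik, if_neg hik, segreBlock, if_neg this, add_zero]

theorem segreBlock_mul_transpose {n : ℕ} (g : SegreGroup n) (r s r' s' : Fin 2) :
    segreBlock g r s * (segreBlock g r' s')ᵀ =
      Matrix.diagonal fun i => (g.left i).1 r s * (g.left i).1 r' s' := by
  ext i k
  rw [Matrix.mul_apply, Finset.sum_eq_single (g.right⁻¹ i)]
  · by_cases hik : i = k
    · subst hik; simp [segreBlock]
    · have : ¬ k = i := fun hc => hik hc.symm
      simp [segreBlock, hik, this]
  · intro j _ hj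
    have : ¬ i = g.right j := fun hc => hj (by rw [hc]; simp)
    simp [segreBlock, this]
  · simp

/-- The `2n × 2n` matrix of an element of `SL(2)^n ⋊ S_n`. -/
def segreMatrix {n : ℕ} (g : SegreGroup n) : Matrix (Fin n ⊕ Fin n) (Fin n ⊕ Fin n) ℂ :=
  Matrix.fromBlocks (segreBlock g 0 0) (segreBlock g 0 1) (segreBlock g 1 0) (segreBlock g 1 1)

theorem segreMatrix_mem {n : ℕ} (g : SegreGroup n) :
    segreMatrix g ∈ Matrix.symplecticGroup (Fin n) ℂ := by
  have hdet : ∀ i, (g.left i).1 0 0 * (g.left i).1 1 1 - (g.left i).1 0 1 * (g.left i).1 1 0 = 1 :=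
    fun i => by rw [← Matrix.det_fin_two]; exact (g.left i).2
  rw [SymplecticGroup.mem_iff, segreMatrix, Matrix.J, Matrix.fromBlocks_transpose,
    Matrix.fromBlocks_multiply, Matrix.fromBlocks_multiply]
  simp only [Matrix.mul_zero, Matrix.mul_one, Matrix.mul_neg, zero_add, add_zero, Matrix.neg_mul,
    segreBlock_mul_transpose]
  congr 1 <;> ext i j <;> by_cases hij : i = j
  all_goals first
    | subst hij
      simp only [Matrix.add_apply, Matrix.neg_apply, Matrix.diagonal_apply_eq, Matrix.zero_apply,
        Matrix.one_apply_eq]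
      first
        | ring1
        | linear_combination -hdet i
        | linear_combination hdet i
    | simp [hij]

/-- The homomorphism `SL(2)^n ⋊ S_n → Sp(2n)`. -/
def segreToSymplectic (n : ℕ) : SegreGroup n →* Matrix.symplecticGroup (Fin n) ℂ where
  toFun g := ⟨segreMatrix g, segreMatrix_mem g⟩
  map_one' := by
    apply Subtype.ext
    change segreMatrix 1 = 1
    rw [← Matrix.fromBlocks_one, segreMatrix]
    congr 1 <;> ext i j <;> simp [segreBlock]
  map_mul' g h := by
    apply Subtype.ext
    change segreMatrix (g * h) = segreMatrix g * segreMatrix h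
    simp only [segreMatrix, Matrix.fromBlocks_multiply, segreBlock_mul]

/-- The action on tensors: `SL(2)^n` acts factor by factor and `S_n` permutes the factors, so that
`(g, σ)` maps `v_1 ⊗ … ⊗ v_n` to the tensor with `i`-th factor `g i` applied to
`v_(σ⁻¹ i)`. -/
def tensorAction (n : ℕ) : SegreGroup n →* Module.End ℂ (TensorSpace n) where
  toFun g :=
    { toFun := fun z I => ∑ J : Fin n → Fin 2,
        (∏ i, (g.left i).1 (I i) (J i)) * z (J ∘ g.right)
      map_add' := fun z w => by
        ext I; simp [mul_add, Finset.sum_add_distrib]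
      map_smul' := fun c z => by
        ext I; simp [Finset.mul_sum, mul_left_comm] }
  map_one' := by
    apply LinearMap.ext; intro z; funext I
    change (∑ J : Fin n → Fin 2, (∏ i, (1 : Matrix (Fin 2) (Fin 2) ℂ) (I i) (J i)) * z J) = z I
    rw [Finset.sum_eq_single I]
    · simp
    · intro J _ hJ
      obtain ⟨i, hi⟩ := Function.ne_iff.1 hJ
      have h0 : (∏ i, (1 : Matrix (Fin 2) (Fin 2) ℂ) (I i) (J i)) = 0 :=
        Finset.prod_eq_zero (Finset.mem_univ i) (Matrix.one_apply_ne fun h => hi h.symm)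
      exact mul_eq_zero_of_left h0 _
    · simp
  map_mul' g h := by
    apply LinearMap.ext; intro z; funext I
    change (∑ K : Fin n → Fin 2, (∏ i, ((g * h).left i).1 (I i) (K i)) * z (K ∘ (g * h).right)) =
      ∑ J : Fin n → Fin 2, (∏ i, (g.left i).1 (I i) (J i)) *
        ∑ K : Fin n → Fin 2, (∏ i, (h.left i).1 ((J ∘ g.right) i) (K i)) * z (K ∘ h.right)
    have e : ∀ J : Fin n → Fin 2,
        (∑ K : Fin n → Fin 2, (∏ i, (h.left i).1 ((J ∘ g.right) i) (K i)) * z (K ∘ h.right)) =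
        ∑ K : Fin n → Fin 2, (∏ i, (h.left (g.right⁻¹ i)).1 (J i) (K i)) *
          z (K ∘ (g * h).right) := by
      intro J
      symm
      refine Fintype.sum_equiv (Equiv.arrowCongr g.right.symm (Equiv.refl (Fin 2))) _ _ ?_
      intro K
      congr 1
      refine Fintype.prod_equiv g.right.symm _ _ ?_
      intro i
      simp [Equiv.Perm.inv_def]
    simp_rw [e, Finset.mul_sum]
    rw [Finset.sum_comm]
    refine Finset.sum_congr rfl fun K _ => ?_
    simp_rw [← mul_assoc, ← Finset.sum_mul, ← Finset.prod_mul_distrib]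
    congr 1
    rw [← Fintype.piFinset_univ]
    refine Eq.trans ?_ (Finset.prod_univ_sum (fun _ => Finset.univ) fun i s =>
      (g.left i).1 (I i) s * (h.left (g.right⁻¹ i)).1 s (K i))
    refine Finset.prod_congr rfl fun i _ => ?_
    change ((g.left i).1 * (h.left (g.right⁻¹ i)).1) (I i) (K i) = _
    rw [Matrix.mul_apply]

/-- The same action with values in the general linear group, which acts on projective space. -/
def tensorActionGL (n : ℕ) : SegreGroup n →* LinearMap.GeneralLinearGroup ℂ (TensorSpace n) :=
  (tensorAction n).toHomUnits

end

/-! E-rank at most one means that `A i j * A k l = A i l * A k j` whenever rows and columns are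
disjoint; with symmetry these equations cut out `X`. They hold for `diag(d) + y yᵀ`. Conversely,
consider the graph of nonzero off-diagonal entries of `A ∈ X`. If it has a triangle, the equations
recover `y` up to sign and `A` is exactly of that form (`exists_diagonalAddRankOne_eq_of_triangle`).
If not, any two edges meet, the graph is a star or empty, and `A` is a limit of such matrices
(`mem_closure_of_star`). So `X` is the closure of the image of an affine space, hence irreducible.
For three distinct indices `y_i²` is a quotient of off-diagonal entries, so for `n ≥ 3` the
variables `d, y` are algebraic over the coordinate ring and the dimension is `2n`.

Principal minors of `A` are the maximal minors of the stacked matrix `[1; A]` that take one row from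
each pair `(i, n + i)`. The group mixes rows within pairs and permutes the pairs; multilinearity of
the determinant turns this into the tensor action, up to the scalar `± det (P + QA)`
(`tensorAction_principalMinorVector`). For generic `(d, y)` the transform of `diag(d) + y yᵀ` is
again diagonal plus rank one (`mem_exclusiveRankLEOne_of_segreBlock`), and closedness extends
invariance from generic points to all of `φ(X)`. -/

/-! ### Zariski topology: continuity, irreducibility and density -/

theorem isClosed_affineZariski_iff {σ : Type} {Z : Set (σ → ℂ)} :
    IsClosed[affineZariski σ] Z ↔
      ∃ T : Set (MvPolynomial σ ℂ), Z = {x | ∀ f ∈ T, MvPolynomial.eval x f = 0} := by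
  rw [← @isOpen_compl_iff _ _ (affineZariski σ)]
  change Zᶜᶜ ∈ _ ↔ _
  rw [compl_compl]
  rfl

theorem isClosed_projectiveZariski_iff {σ : Type} {Z : Set (ℙ ℂ (σ → ℂ))} :
    IsClosed[projectiveZariski σ] Z ↔
      ∃ T : Set (MvPolynomial σ ℂ), (∀ f ∈ T, ∃ d, f.IsHomogeneous d) ∧
        Z = {p | ∀ f ∈ T, MvPolynomial.eval p.rep f = 0} := by
  rw [← @isOpen_compl_iff _ _ (projectiveZariski σ)]
  change Zᶜᶜ ∈ _ ↔ _
  rw [compl_compl]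
  rfl

/-- Projective closed sets are defined through the chosen representative `rep`; homogeneity makes
that choice irrelevant. -/
theorem MvPolynomial.IsHomogeneous.eval_rep_mk_eq_zero_iff {σ : Type} {f : MvPolynomial σ ℂ}
    {d : ℕ} (hf : f.IsHomogeneous d) (v : σ → ℂ) (hv : v ≠ 0) :
    MvPolynomial.eval (Projectivization.mk ℂ v hv).rep f = 0 ↔ MvPolynomial.eval v f = 0 := by
  obtain ⟨a, ha⟩ := Projectivization.exists_smul_eq_mk_rep ℂ v hv
  have : MvPolynomial.eval ((a : ℂ) • v) f = (a : ℂ) ^ d * MvPolynomial.eval v f := by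
    rw [MvPolynomial.eval_eq, MvPolynomial.eval_eq, Finset.mul_sum]
    refine Finset.sum_congr rfl fun m hm => ?_
    have hd : m.degree = d := by
      rw [Finsupp.degree_eq_weight_one]; exact hf (MvPolynomial.mem_support_iff.1 hm)
    simp only [Pi.smul_apply, smul_eq_mul, mul_pow, Finset.prod_mul_distrib,
      Finset.prod_pow_eq_pow_sum]
    rw [← Finsupp.degree_apply, hd]
    ring
  rw [← ha, Units.smul_def, this, mul_eq_zero, or_iff_right (pow_ne_zero _ a.ne_zero)]

theorem MvPolynomial.eval_eval_eq_eval_bind₁ {σ τ : Type} (F : τ → MvPolynomial σ ℂ) (x : σ → ℂ)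
    (p : MvPolynomial τ ℂ) :
    MvPolynomial.eval (fun t => MvPolynomial.eval x (F t)) p =
      MvPolynomial.eval x (MvPolynomial.bind₁ F p) := by
  rw [← MvPolynomial.aeval_eq_eval, ← MvPolynomial.aeval_eq_eval]
  simp [MvPolynomial.aeval_bind₁]

theorem continuous_affineZariski {σ τ : Type} {f : (σ → ℂ) → τ → ℂ} (F : τ → MvPolynomial σ ℂ)
    (hF : ∀ x t, f x t = MvPolynomial.eval x (F t)) :
    @Continuous _ _ (affineZariski σ) (affineZariski τ) f := by
  rw [@continuous_iff_isClosed _ _ (affineZariski σ) (affineZariski τ)]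
  intro Z hZ
  obtain ⟨T, rfl⟩ := isClosed_affineZariski_iff.1 hZ
  refine isClosed_affineZariski_iff.2 ⟨MvPolynomial.bind₁ F '' T, ?_⟩
  ext x
  have hx : f x = fun t => MvPolynomial.eval x (F t) := funext (hF x)
  simp [hx, MvPolynomial.eval_eval_eq_eval_bind₁]

theorem continuous_affineZariski_mk {σ τ : Type} {v : (σ → ℂ) → τ → ℂ} (hv : ∀ x, v x ≠ 0)
    (F : τ → MvPolynomial σ ℂ) (hF : ∀ x t, v x t = MvPolynomial.eval x (F t)) :
    @Continuous _ _ (affineZariski σ) (projectiveZariski τ)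
      (fun x => Projectivization.mk ℂ (v x) (hv x)) := by
  rw [@continuous_iff_isClosed _ _ (affineZariski σ) (projectiveZariski τ)]
  intro Z hZ
  obtain ⟨T, hT, rfl⟩ := isClosed_projectiveZariski_iff.1 hZ
  refine isClosed_affineZariski_iff.2 ⟨MvPolynomial.bind₁ F '' T, ?_⟩
  ext x
  have hx : v x = fun t => MvPolynomial.eval x (F t) := funext (hF x)
  simp only [Set.mem_preimage, Set.mem_ofPred_eq, Set.forall_mem_image]
  refine forall₂_congr fun f hf => ?_
  obtain ⟨d, hd⟩ := hT f hf
  rw [hd.eval_rep_mk_eq_zero_iff, hx, MvPolynomial.eval_eval_eq_eval_bind₁]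

theorem continuous_projectiveZariski_smul {τ : Type} [Fintype τ]
    (g : LinearMap.GeneralLinearGroup ℂ (τ → ℂ)) :
    @Continuous _ _ (projectiveZariski τ) (projectiveZariski τ) (fun p => g • p) := by
  classical
  rw [@continuous_iff_isClosed _ _ (projectiveZariski τ) (projectiveZariski τ)]
  intro Z hZ
  obtain ⟨T, hT, rfl⟩ := isClosed_projectiveZariski_iff.1 hZ
  set F : τ → MvPolynomial τ ℂ := fun t =>
    ∑ s, MvPolynomial.C (g.1 (Pi.single s 1) t) * MvPolynomial.X s with hF
  have hFh : ∀ t, (F t).IsHomogeneous 1 := fun t =>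
    MvPolynomial.IsHomogeneous.sum _ _ _ fun s _ => MvPolynomial.isHomogeneous_C_mul_X _ _
  have hFe : ∀ v : τ → ℂ, g • v = fun t => MvPolynomial.eval v (F t) := by
    intro v
    funext t
    change g.1 v t = _
    conv_lhs => rw [← LinearMap.sum_single_apply (φ := fun _ : τ => ℂ) v]
    rw [map_sum, Finset.sum_apply]
    simp only [hF, map_sum, map_mul, MvPolynomial.eval_C, MvPolynomial.eval_X]
    refine Finset.sum_congr rfl fun s _ => ?_
    have : (LinearMap.single ℂ (fun _ : τ => ℂ) s) (v s) = v s • Pi.single s (1 : ℂ) := by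
      ext i; by_cases h : i = s
      · subst h; simp
      · simp [h]
    change g.1 ((LinearMap.single ℂ (fun _ : τ => ℂ) s) (v s)) t = _
    rw [this, map_smul, Pi.smul_apply, smul_eq_mul, mul_comm]
  refine isClosed_projectiveZariski_iff.2 ⟨MvPolynomial.bind₁ F '' T, ?_, ?_⟩
  · rintro _ ⟨f, hf, rfl⟩
    obtain ⟨d, hd⟩ := hT f hf
    exact ⟨1 * d, hd.aeval F hFh⟩
  ext p
  induction p using Projectivization.ind with | _ v hv => ?_
  simp only [Set.mem_preimage, Set.mem_ofPred_eq, Set.forall_mem_image]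
  refine forall₂_congr fun f hf => ?_
  obtain ⟨d, hd⟩ := hT f hf
  rw [Projectivization.smul_mk, hd.eval_rep_mk_eq_zero_iff,
    MvPolynomial.IsHomogeneous.eval_rep_mk_eq_zero_iff (f := MvPolynomial.bind₁ F f)
      (hd.aeval F hFh),
    hFe, MvPolynomial.eval_eval_eq_eval_bind₁]

theorem isIrreducible_univ_affineZariski (σ : Type) :
    @IsIrreducible _ (affineZariski σ) (Set.univ : Set (σ → ℂ)) := by
  let _ := affineZariski σ
  refine ⟨Set.univ_nonempty, ?_⟩
  rw [isPreirreducible_iff_isClosed_union_isClosed]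
  intro Z W hZ hW hZW
  obtain ⟨S, rfl⟩ := isClosed_affineZariski_iff.1 hZ
  obtain ⟨T, rfl⟩ := isClosed_affineZariski_iff.1 hW
  by_contra! hcon
  obtain ⟨⟨x, -, hx⟩, ⟨y, -, hy⟩⟩ := Set.not_subset.1 hcon.1, Set.not_subset.1 hcon.2
  simp only [Set.mem_ofPred_eq, not_forall] at hx hy
  obtain ⟨⟨f, hf, hfx⟩, ⟨g, hg, hgy⟩⟩ := hx, hy
  have hfg : f * g = 0 := MvPolynomial.funext fun z => by
    rw [map_mul, map_zero]
    rcases hZW (Set.mem_univ z) with h | h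
    · rw [h f hf, zero_mul]
    · rw [h g hg, mul_zero]
  rcases mul_eq_zero.1 hfg with rfl | rfl
  · exact hfx (map_zero _)
  · exact hgy (map_zero _)

/-- Nonempty basic open sets are dense: `h * f` vanishes everywhere and the polynomial ring is a
domain. This drives both the limit to a star and the passage from generic points to all points. -/
theorem eq_univ_of_isClosed_affineZariski {σ : Type} {Z : Set (σ → ℂ)}
    (hZ : IsClosed[affineZariski σ] Z) {h : MvPolynomial σ ℂ} (h0 : h ≠ 0)
    (hh : ∀ x, MvPolynomial.eval x h ≠ 0 → x ∈ Z) : Z = Set.univ := by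
  obtain ⟨T, rfl⟩ := isClosed_affineZariski_iff.1 hZ
  refine Set.eq_univ_of_forall fun x f hf => ?_
  have : h * f = 0 := MvPolynomial.funext fun z => by
    rw [map_mul, map_zero]
    by_cases hz : MvPolynomial.eval z h = 0
    · rw [hz, zero_mul]
    · rw [hh z hz f hf, mul_zero]
  rw [(mul_eq_zero.1 this).resolve_left h0, map_zero]

/-! ### The quadrics defining exclusive rank at most one -/

theorem minor_eq_det_of_card_eq {n k : ℕ} (A : Matrix (Fin n) (Fin n) ℂ) (I J : Finset (Fin n))
    (h : I.card = J.card) (hI : I.card = k) (hJ : J.card = k) :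
    minor A I J h = (A.submatrix (I.orderEmbOfFin hI) (J.orderEmbOfFin hJ)).det := by
  subst hI
  rfl

theorem orderEmbOfFin_pair {n : ℕ} {i k : Fin n} (h : ({i, k} : Finset (Fin n)).card = 2) :
    (({i, k} : Finset (Fin n)).orderEmbOfFin h 0 = i ∧
      ({i, k} : Finset (Fin n)).orderEmbOfFin h 1 = k) ∨
    (({i, k} : Finset (Fin n)).orderEmbOfFin h 0 = k ∧
      ({i, k} : Finset (Fin n)).orderEmbOfFin h 1 = i) := by
  have h0 := Finset.orderEmbOfFin_mem ({i, k} : Finset (Fin n)) h 0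
  have h1 := Finset.orderEmbOfFin_mem ({i, k} : Finset (Fin n)) h 1
  have hne : ({i, k} : Finset (Fin n)).orderEmbOfFin h 0 ≠
      ({i, k} : Finset (Fin n)).orderEmbOfFin h 1 := by simp
  simp only [Finset.mem_insert, Finset.mem_singleton] at h0 h1
  grind

/-- The cases `i = k` and `j = l` are trivial identities, so allowing them is harmless and spares
later distinctness checks. -/
theorem exclusiveRank_le_one_iff {n : ℕ} (A : Matrix (Fin n) (Fin n) ℂ) :
    exclusiveRank A ≤ 1 ↔
      ∀ i k j l, i ≠ j → i ≠ l → k ≠ j → k ≠ l → A i j * A k l = A i l * A k j := by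
  constructor
  · intro h i k j l hij hil hkj hkl
    by_cases hik : i = k
    · subst hik; ring
    by_cases hjl : j = l
    · subst hjl; ring
    -- The infimum is attained because the set contains `n`: no index set has `n + 1` elements.
    have hmem := Nat.sInf_mem (s := {k | ∀ (I J : Finset (Fin n)) (h : I.card = J.card),
      I.card = k + 1 → Disjoint I J → minor A I J h = 0}) ⟨n, fun I J _ hI _ => by
        have := I.card_le_univ
        rw [Fintype.card_fin] at this
        omega⟩
    rw [← exclusiveRank] at hmem
    rcases Nat.le_one_iff_eq_zero_or_eq_one.1 h with h0 | h1
    · rw [h0] at hmem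
      have hz : ∀ p q, p ≠ q → A p q = 0 := by
        intro p q hpq
        have := hmem {p} {q} (by simp) (by simp) (by simpa using hpq)
        rw [minor_eq_det_of_card_eq A _ _ _ (k := 1) (by simp) (by simp), Matrix.det_fin_one,
          Matrix.submatrix_apply] at this
        simpa using this
      rw [hz i j hij, hz i l hil]; ring
    · rw [h1] at hmem
      have hI := Finset.card_pair hik
      have hJ := Finset.card_pair hjl
      have := hmem {i, k} {j, l} (hI.trans hJ.symm) hI (by
        simp [hij.symm, hil.symm, hkj.symm, hkl.symm])
      rw [minor_eq_det_of_card_eq A _ _ _ hI hJ, Matrix.det_fin_two] at this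
      simp only [Matrix.submatrix_apply] at this
      -- The increasing order of each pair is unknown; it only affects the sign of the minor.
      rcases orderEmbOfFin_pair hI with ⟨e1, e2⟩ | ⟨e1, e2⟩ <;>
      rcases orderEmbOfFin_pair hJ with ⟨e3, e4⟩ | ⟨e3, e4⟩ <;>
      rw [e1, e2, e3, e4] at this
      · linear_combination this
      · linear_combination -this
      · linear_combination -this
      · linear_combination this
  · intro h
    refine Nat.sInf_le fun I J hIJ hI hd => ?_
    have hJ : J.card = 2 := hIJ ▸ hI
    rw [minor_eq_det_of_card_eq A _ _ _ hI hJ, Matrix.det_fin_two]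
    have hne : ∀ a b, I.orderEmbOfFin hI a ≠ J.orderEmbOfFin hJ b := fun a b =>
      Finset.disjoint_iff_ne.1 hd _ (I.orderEmbOfFin_mem hI a) _ (J.orderEmbOfFin_mem hJ b)
    simp only [Matrix.submatrix_apply]
    rw [h _ _ _ _ (hne 0 0) (hne 0 1) (hne 1 0) (hne 1 1), sub_self]

/-! ### Diagonal plus rank-one matrices -/

theorem mem_exclusiveRankLEOne_of_eq_mul {n : ℕ} {A : Matrix (Fin n) (Fin n) ℂ} (hA : A.IsSymm)
    {w z : Fin n → ℂ} (h : ∀ i j, i ≠ j → A i j = w i * z j) : A ∈ exclusiveRankLEOne n := by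
  refine ⟨hA, (exclusiveRank_le_one_iff A).2 fun i k j l hij hil hkj hkl => ?_⟩
  rw [h _ _ hij, h _ _ hil, h _ _ hkj, h _ _ hkl]
  ring

/-- The symmetric matrix `diag(d) + y yᵀ`, where the vector `(d, y)` is indexed by a disjoint
union. -/
def diagonalAddRankOne {n : ℕ} (x : Fin n ⊕ Fin n → ℂ) : Matrix (Fin n) (Fin n) ℂ :=
  Matrix.diagonal (x ∘ Sum.inl) + Matrix.vecMulVec (x ∘ Sum.inr) (x ∘ Sum.inr)

/-- The matrix of polynomials that gives `diagonalAddRankOne`. -/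
noncomputable def genericDiagonalAddRankOne (n : ℕ) :
    Matrix (Fin n) (Fin n) (MvPolynomial (Fin n ⊕ Fin n) ℂ) :=
  Matrix.diagonal (fun i => MvPolynomial.X (Sum.inl i)) +
    Matrix.vecMulVec (fun i => MvPolynomial.X (Sum.inr i)) (fun i => MvPolynomial.X (Sum.inr i))

theorem map_eval_genericDiagonalAddRankOne {n : ℕ} (x : Fin n ⊕ Fin n → ℂ) :
    (genericDiagonalAddRankOne n).map (MvPolynomial.eval x) = diagonalAddRankOne x := by
  ext i j
  by_cases hij : i = j
  · subst hij
    simp [genericDiagonalAddRankOne, diagonalAddRankOne, Matrix.vecMulVec_apply]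
  · simp [genericDiagonalAddRankOne, diagonalAddRankOne, Matrix.vecMulVec_apply, hij]

theorem continuous_matrixPoint_diagonalAddRankOne (n : ℕ) :
    @Continuous _ _ (affineZariski (Fin n ⊕ Fin n)) (affineZariski (Fin n × Fin n))
      (fun x => matrixPoint (diagonalAddRankOne x)) :=
  continuous_affineZariski (fun p => genericDiagonalAddRankOne n p.1 p.2) fun x p => by
    rw [← map_eval_genericDiagonalAddRankOne]; rfl

theorem range_diagonalAddRankOne (n : ℕ) :
    (Set.range fun p : (Fin n → ℂ) × (Fin n → ℂ) =>
        matrixPoint (Matrix.diagonal p.1 + Matrix.vecMulVec p.2 p.2)) =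
      Set.range fun x : Fin n ⊕ Fin n → ℂ => matrixPoint (diagonalAddRankOne x) := by
  ext z
  constructor
  · rintro ⟨p, rfl⟩
    exact ⟨Sum.elim p.1 p.2, rfl⟩
  · rintro ⟨x, rfl⟩
    exact ⟨(x ∘ Sum.inl, x ∘ Sum.inr), rfl⟩

theorem diagonalAddRankOne_apply_of_ne {n : ℕ} (x : Fin n ⊕ Fin n → ℂ) {i j : Fin n} (h : i ≠ j) :
    diagonalAddRankOne x i j = x (Sum.inr i) * x (Sum.inr j) := by
  simp [diagonalAddRankOne, Matrix.vecMulVec_apply, h]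

theorem isSymm_diagonalAddRankOne {n : ℕ} (x : Fin n ⊕ Fin n → ℂ) :
    (diagonalAddRankOne x).IsSymm := by
  rw [Matrix.IsSymm, diagonalAddRankOne, Matrix.transpose_add, Matrix.diagonal_transpose,
    Matrix.transpose_vecMulVec]

theorem diagonalAddRankOne_mem {n : ℕ} (x : Fin n ⊕ Fin n → ℂ) :
    diagonalAddRankOne x ∈ exclusiveRankLEOne n :=
  mem_exclusiveRankLEOne_of_eq_mul (isSymm_diagonalAddRankOne x)
    fun _ _ h => diagonalAddRankOne_apply_of_ne x h

theorem exists_diagonalAddRankOne_eq {n : ℕ} {A : Matrix (Fin n) (Fin n) ℂ} (y : Fin n → ℂ)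
    (h : ∀ i j, i ≠ j → A i j = y i * y j) : ∃ x, diagonalAddRankOne x = A := by
  refine ⟨Sum.elim (fun i => A i i - y i * y i) y, ?_⟩
  ext i j
  by_cases hij : i = j
  · subst hij; simp [diagonalAddRankOne, Matrix.vecMulVec_apply]
  · rw [diagonalAddRankOne_apply_of_ne _ hij, h i j hij]; rfl

/-! ### Density of the parametrization -/

/-- The triangle forces `y_i² = A i j * A i k / A j k`; a square root `r` of this gives `y_i = r`
and `y_m = A i m / r` for `m ≠ i`. -/
theorem exists_diagonalAddRankOne_eq_of_triangle {n : ℕ} {A : Matrix (Fin n) (Fin n) ℂ}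
    (hA : A ∈ exclusiveRankLEOne n) {i j k : Fin n} (hij : i ≠ j) (hik : i ≠ k) (hjk : j ≠ k)
    (aij : A i j ≠ 0) (aik : A i k ≠ 0) (ajk : A j k ≠ 0) : ∃ x, diagonalAddRankOne x = A := by
  obtain ⟨hs, hr⟩ := hA
  rw [exclusiveRank_le_one_iff] at hr
  have hs' : ∀ p q, A p q = A q p := fun p q => hs.apply q p
  obtain ⟨r, hr2⟩ := IsAlgClosed.exists_pow_nat_eq (A i j * A i k / A j k) (n := 2) (by norm_num)
  have hr0 : r ≠ 0 := by
    rintro rfl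
    have : A i j * A i k / A j k ≠ 0 := div_ne_zero (mul_ne_zero aij aik) ajk
    exact this (by rw [← hr2]; simp)
  have hr3 : r ^ 2 * A j k = A i j * A i k := by rw [hr2]; field_simp
  -- This is `y_m y_p = A m p` with denominators cleared. In general it takes two exchanges;
  -- coincidences with `j` or `k` are separate, since the quadrics need disjoint rows and columns.
  have key : ∀ m p, m ≠ i → p ≠ i → m ≠ p →
      A i m * A i p * A j k = A m p * (A i j * A i k) := by
    intro m p hmi hpi hmp
    by_cases hmj : m = j
    · subst hmj
      by_cases hpk : p = k
      · subst hpk; ring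
      · have := hr i m p k hpi.symm hik hmp hjk
        linear_combination A i m * this
    by_cases hmk : m = k
    · subst hmk
      by_cases hpj : p = j
      · subst hpj; rw [hs' m p]; ring
      · have := hr i m p j hpi.symm hij hmp hjk.symm
        linear_combination A i m * this + A i m * A i p * hs' j m
    by_cases hpj : p = j
    · subst hpj
      have := hr i p m k hmi.symm hik hmp.symm hjk
      linear_combination A i p * this + A i k * A i p * hs' p m
    by_cases hpk : p = k
    · subst hpk
      have := hr i p m j hmi.symm hij hmp.symm hjk.symm
      linear_combination A i p * this + A i m * A i p * hs' j p + A i j * A i p * hs' p m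
    have h1 := hr i k p j hpi.symm hij (Ne.symm hpk) hjk.symm
    have h2 := hr i p m k hmi.symm hik hmp.symm hpk
    linear_combination A i m * h1 + A i j * h2 + A i m * A i p * hs' j k +
      A i j * A i m * hs' k p + A i j * A i k * hs' p m
  refine exists_diagonalAddRankOne_eq (fun m => if m = i then r else A i m / r) fun m p hmp => ?_
  by_cases hm : m = i
  · subst hm
    rw [if_pos rfl, if_neg (Ne.symm hmp)]
    field_simp
  by_cases hp : p = i
  · subst hp
    rw [if_pos rfl, if_neg hm, hs']
    field_simp
  rw [if_neg hm, if_neg hp]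
  have h3 := key m p hm hp hmp
  field_simp
  apply mul_right_cancel₀ ajk
  linear_combination A m p * hr3 - h3

/-- The line `γ` fills the zero entries away from `c` with `s * A c i * A c j`. For `s = r² ≠ 0` it
lies in the image, via `y_c = r⁻¹` and `y_i = r * A c i`; at `s = 0` it passes through `A`. -/
theorem mem_closure_of_star {n : ℕ} {A : Matrix (Fin n) (Fin n) ℂ} (hA : A.IsSymm) (c : Fin n)
    (hc : ∀ i j, i ≠ j → i ≠ c → j ≠ c → A i j = 0) :
    matrixPoint A ∈ closure[affineZariski (Fin n × Fin n)]
      (Set.range fun x : Fin n ⊕ Fin n → ℂ => matrixPoint (diagonalAddRankOne x)) := by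
  have hs : ∀ p q, A p q = A q p := fun p q => hA.apply q p
  set γ : (Unit → ℂ) → Fin n × Fin n → ℂ := fun s p =>
    if p.1 = p.2 ∨ p.1 = c ∨ p.2 = c then A p.1 p.2 else s () * (A c p.1 * A c p.2) with hγ
  have hcont : @Continuous _ _ (affineZariski Unit) (affineZariski (Fin n × Fin n)) γ :=
    continuous_affineZariski (fun p =>
      if p.1 = p.2 ∨ p.1 = c ∨ p.2 = c then MvPolynomial.C (A p.1 p.2)
      else MvPolynomial.X () * MvPolynomial.C (A c p.1 * A c p.2)) fun s p => by
        simp only [hγ]; split_ifs <;> simp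
  have hcl := @IsClosed.preimage _ _ (affineZariski Unit) (affineZariski (Fin n × Fin n)) _ hcont _
    (@isClosed_closure _ (affineZariski (Fin n × Fin n)) (Set.range fun x : Fin n ⊕ Fin n → ℂ =>
      matrixPoint (diagonalAddRankOne x)))
  have huniv := eq_univ_of_isClosed_affineZariski hcl (h := MvPolynomial.X ())
    (MvPolynomial.X_ne_zero _) fun s hs0 => by
      rw [MvPolynomial.eval_X] at hs0
      apply @subset_closure _ (affineZariski (Fin n × Fin n))
      obtain ⟨r, hr⟩ := IsAlgClosed.exists_pow_nat_eq (s ()) (n := 2) (by norm_num)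
      have hr0 : r ≠ 0 := by rintro rfl; exact hs0 (by rw [← hr]; simp)
      obtain ⟨x, hx⟩ := exists_diagonalAddRankOne_eq
        (A := fun i j => γ s (i, j)) (fun i => if i = c then r⁻¹ else r * A c i) (by
          intro i j hij
          simp only [hγ]
          by_cases hi : i = c
          · subst hi
            simp [Ne.symm hij, hr0]
          by_cases hj : j = c
          · subst hj
            simp only [hi, or_true, if_true, if_false, hs i j]
            field_simp
          simp only [hij, hi, hj, if_false, or_self, ← hr]
          ring)
      exact ⟨x, by simp only [hx]; rfl⟩
  have h0 : (fun _ => 0 : Unit → ℂ) ∈ γ ⁻¹' (closure[affineZariski (Fin n × Fin n)]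
      (Set.range fun x : Fin n ⊕ Fin n → ℂ => matrixPoint (diagonalAddRankOne x))) := by
    rw [huniv]; trivial
  have hγ0 : γ (fun _ => 0) = matrixPoint A := by
    funext ⟨i, j⟩
    simp only [hγ, matrixPoint, zero_mul]
    split_ifs with h
    · rfl
    · push Not at h
      exact (hc i j h.1 h.2.1 h.2.2).symm
  rw [← hγ0]
  exact h0

theorem mem_closure_of_mem_exclusiveRankLEOne {n : ℕ} {A : Matrix (Fin n) (Fin n) ℂ}
    (hA : A ∈ exclusiveRankLEOne n) :
    matrixPoint A ∈ closure[affineZariski (Fin n × Fin n)]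
      (Set.range fun x : Fin n ⊕ Fin n → ℂ => matrixPoint (diagonalAddRankOne x)) := by
  have hrange : (∃ x, diagonalAddRankOne x = A) →
      matrixPoint A ∈ closure[affineZariski (Fin n × Fin n)]
        (Set.range fun x : Fin n ⊕ Fin n → ℂ => matrixPoint (diagonalAddRankOne x)) := by
    rintro ⟨x, rfl⟩
    exact @subset_closure _ (affineZariski (Fin n × Fin n)) _ _ ⟨x, rfl⟩
  by_cases htri : ∃ i j k, i ≠ j ∧ i ≠ k ∧ j ≠ k ∧ A i j ≠ 0 ∧ A i k ≠ 0 ∧ A j k ≠ 0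
  · obtain ⟨i, j, k, hij, hik, hjk, a, b, c⟩ := htri
    exact hrange (exists_diagonalAddRankOne_eq_of_triangle hA hij hik hjk a b c)
  have hs : ∀ p q, A p q = A q p := fun p q => hA.1.apply q p
  have hr := (exclusiveRank_le_one_iff A).1 hA.2
  by_cases hoff : ∀ i j, i ≠ j → A i j = 0
  · exact hrange (exists_diagonalAddRankOne_eq 0 (by simpa using hoff))
  push Not at htri hoff
  obtain ⟨i, j, hij, aij⟩ := hoff
  -- An edge `kl` disjoint from `ij` would make `A i l` and `A l j` nonzero, closing a triangle `i,
  -- j, l`.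
  have hmeet : ∀ k l, k ≠ l → k ≠ i → k ≠ j → l ≠ i → l ≠ j → A k l = 0 := by
    intro k l hkl hki hkj hli hlj
    by_contra akl
    have h1 := hr i k j l hij hli.symm hkj hkl
    have h2 := hr i l j k hij hki.symm hlj hkl.symm
    have h3 : A i j * A k l ≠ 0 := mul_ne_zero aij akl
    have h4 : A i j * A l k ≠ 0 := by rw [hs l k]; exact h3
    rw [h1] at h3
    rw [h2] at h4
    refine right_ne_zero_of_mul h4 ?_
    rw [hs]
    exact htri i j l hij hli.symm hlj.symm aij (left_ne_zero_of_mul h3)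
  -- The centre is `i` if it has a neighbour besides `j`; otherwise `j` serves.
  by_cases hi : ∃ k, k ≠ i ∧ k ≠ j ∧ A i k ≠ 0
  · obtain ⟨k, hki, hkj, aik⟩ := hi
    refine mem_closure_of_star hA.1 i fun p q hpq hp hq => ?_
    have hj : ∀ q, q ≠ j → q ≠ i → A j q = 0 := by
      intro q hqj hqi
      by_cases hqk : q = k
      · subst hqk
        exact htri i j q hij hqi.symm hqj.symm aij aik
      · have h1 := hr i j k q hki.symm hqi.symm hkj.symm hqj.symm
        rw [htri i j k hij hki.symm hkj.symm aij aik, mul_zero] at h1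
        exact (mul_eq_zero.1 h1).resolve_left aik
    by_cases hpj : p = j
    · subst hpj; exact hj q hpq.symm hq
    by_cases hqj : q = j
    · subst hqj; rw [hs]; exact hj p hpq hp
    exact hmeet p q hpq hp hpj hq hqj
  · push Not at hi
    refine mem_closure_of_star hA.1 j fun p q hpq hp hq => ?_
    by_cases hpi : p = i
    · subst hpi; exact hi q hpq.symm hq
    by_cases hqi : q = i
    · subst hqi; rw [hs]; exact hi p hpq hp
    exact hmeet p q hpq hpi hp hqi hq

/-! ### Closedness and irreducibility of `X` -/

theorem isClosed_exclusiveRankLEOne (n : ℕ) :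
    IsClosed[affineZariski (Fin n × Fin n)] (matrixPoint '' exclusiveRankLEOne n) := by
  refine isClosed_affineZariski_iff.2
    ⟨{f | ∃ i j, f = MvPolynomial.X (i, j) - MvPolynomial.X (j, i)} ∪
      {f | ∃ i k j l, i ≠ j ∧ i ≠ l ∧ k ≠ j ∧ k ≠ l ∧
        f = MvPolynomial.X (i, j) * MvPolynomial.X (k, l) -
          MvPolynomial.X (i, l) * MvPolynomial.X (k, j)}, ?_⟩
  ext x
  constructor
  · rintro ⟨A, ⟨hs, hr⟩, rfl⟩ f (⟨i, j, rfl⟩ | ⟨i, k, j, l, h1, h2, h3, h4, rfl⟩)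
    · simp [matrixPoint, hs.apply i j]
    · simp [matrixPoint, (exclusiveRank_le_one_iff A).1 hr i k j l h1 h2 h3 h4]
  · intro hx
    refine ⟨fun i j => x (i, j), ⟨?_, (exclusiveRank_le_one_iff _).2 ?_⟩, rfl⟩
    · ext i j
      have := hx _ (Or.inl ⟨j, i, rfl⟩)
      rw [map_sub, MvPolynomial.eval_X, MvPolynomial.eval_X, sub_eq_zero] at this
      exact this
    · intro i k j l h1 h2 h3 h4
      have := hx _ (Or.inr ⟨i, k, j, l, h1, h2, h3, h4, rfl⟩)
      simpa [sub_eq_zero] using this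

theorem exclusiveRankLEOne_eq_closure (n : ℕ) :
    matrixPoint '' exclusiveRankLEOne n = closure[affineZariski (Fin n × Fin n)]
      (Set.range fun x : Fin n ⊕ Fin n → ℂ => matrixPoint (diagonalAddRankOne x)) := by
  refine Set.Subset.antisymm ?_ ?_
  · rintro _ ⟨A, hA, rfl⟩
    exact mem_closure_of_mem_exclusiveRankLEOne hA
  · refine @closure_minimal _ (affineZariski (Fin n × Fin n)) _ _ ?_ (isClosed_exclusiveRankLEOne n)
    rintro _ ⟨x, rfl⟩
    exact ⟨_, diagonalAddRankOne_mem x, rfl⟩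

theorem isIrreducible_exclusiveRankLEOne (n : ℕ) :
    @IsIrreducible _ (affineZariski (Fin n × Fin n)) (matrixPoint '' exclusiveRankLEOne n) := by
  let _ := affineZariski (Fin n × Fin n)
  let _ := affineZariski (Fin n ⊕ Fin n)
  rw [exclusiveRankLEOne_eq_closure, ← Set.image_univ]
  exact ((isIrreducible_univ_affineZariski (Fin n ⊕ Fin n)).image _
    (continuous_matrixPoint_diagonalAddRankOne n).continuousOn).closure

/-! ### Coordinate ring and dimension -/

theorem mem_vanishingIdeal_exclusiveRankLEOne_iff {n : ℕ} (f : MvPolynomial (Fin n × Fin n) ℂ) :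
    f ∈ MvPolynomial.vanishingIdeal ℂ (matrixPoint '' exclusiveRankLEOne n) ↔
      MvPolynomial.bind₁ (fun p => genericDiagonalAddRankOne n p.1 p.2) f = 0 := by
  have heval : ∀ x : Fin n ⊕ Fin n → ℂ,
      MvPolynomial.eval (matrixPoint (diagonalAddRankOne x)) f = MvPolynomial.eval x
        (MvPolynomial.bind₁ (fun p => genericDiagonalAddRankOne n p.1 p.2) f) := by
    intro x
    rw [← MvPolynomial.eval_eval_eq_eval_bind₁, ← map_eval_genericDiagonalAddRankOne]
    rfl
  rw [MvPolynomial.mem_vanishingIdeal_iff]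
  simp only [MvPolynomial.aeval_eq_eval]
  constructor
  · intro h
    refine MvPolynomial.funext fun x => ?_
    rw [← heval, map_zero]
    exact h _ ⟨_, diagonalAddRankOne_mem x, rfl⟩
  · intro h z hz
    rw [exclusiveRankLEOne_eq_closure] at hz
    have hcl : IsClosed[affineZariski (Fin n × Fin n)] {z | MvPolynomial.eval z f = 0} :=
      isClosed_affineZariski_iff.2 ⟨{f}, by simp⟩
    refine @closure_minimal _ (affineZariski (Fin n × Fin n)) _ _ ?_ hcl z hz
    rintro _ ⟨x, rfl⟩
    change MvPolynomial.eval _ f = 0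
    rw [heval, h, map_zero]

/-- The map on coordinate rings that is dual to `diagonalAddRankOne`. -/
noncomputable def coordinateRingMap (n : ℕ) :
    CoordinateRing (matrixPoint '' exclusiveRankLEOne n) →ₐ[ℂ] MvPolynomial (Fin n ⊕ Fin n) ℂ :=
  Ideal.Quotient.liftₐ _ (MvPolynomial.bind₁ fun p => genericDiagonalAddRankOne n p.1 p.2)
    fun f hf => (mem_vanishingIdeal_exclusiveRankLEOne_iff f).1 hf

theorem coordinateRingMap_mk_X {n : ℕ} (i j : Fin n) :
    coordinateRingMap n (Ideal.Quotient.mk _ (MvPolynomial.X (i, j))) =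
      genericDiagonalAddRankOne n i j := by
  change MvPolynomial.bind₁ _ (MvPolynomial.X (i, j)) = _
  rw [MvPolynomial.bind₁_X_right]

theorem coordinateRingMap_injective (n : ℕ) : Function.Injective (coordinateRingMap n) := by
  rw [injective_iff_map_eq_zero]
  intro a ha
  obtain ⟨f, rfl⟩ := Ideal.Quotient.mk_surjective a
  rw [Ideal.Quotient.eq_zero_iff_mem, mem_vanishingIdeal_exclusiveRankLEOne_iff]
  exact ha

theorem genericDiagonalAddRankOne_apply_of_ne {n : ℕ} {i j : Fin n} (h : i ≠ j) :
    genericDiagonalAddRankOne n i j = MvPolynomial.X (Sum.inr i) * MvPolynomial.X (Sum.inr j) := by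
  simp [genericDiagonalAddRankOne, Matrix.vecMulVec_apply, h]

theorem isAlgebraic_of_forall_isAlgebraic_X {R σ : Type} [CommRing R] [IsDomain R] [Algebra ℂ R]
    [Algebra R (MvPolynomial σ ℂ)] [IsScalarTower ℂ R (MvPolynomial σ ℂ)]
    (h : ∀ s, IsAlgebraic R (MvPolynomial.X s : MvPolynomial σ ℂ)) :
    Algebra.IsAlgebraic R (MvPolynomial σ ℂ) := by
  refine ⟨fun p => ?_⟩
  induction p using MvPolynomial.induction_on with
  | C a =>
    rw [← MvPolynomial.algebraMap_eq, IsScalarTower.algebraMap_apply ℂ R (MvPolynomial σ ℂ)]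
    exact isAlgebraic_algebraMap _
  | add p q hp hq => exact hp.add hq
  | mul_X p s hp => exact hp.mul (h s)

/-- The coordinate ring embeds in `ℂ[d, y]`. Both this ring and the function field are algebraic
over it, so their transcendence degrees agree. -/
theorem varietyDim_exclusiveRankLEOne {n : ℕ} (hn : 3 ≤ n) :
    varietyDim (matrixPoint '' exclusiveRankLEOne n) = ((2 * n : ℕ) : Cardinal) := by
  set R := CoordinateRing (matrixPoint '' exclusiveRankLEOne n) with hR
  have hinj := coordinateRingMap_injective n
  have hdom : IsDomain R := hinj.isDomain (coordinateRingMap n).toRingHom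
  let _ : Algebra R (MvPolynomial (Fin n ⊕ Fin n) ℂ) := (coordinateRingMap n).toRingHom.toAlgebra
  have _ : IsScalarTower ℂ R (MvPolynomial (Fin n ⊕ Fin n) ℂ) :=
    IsScalarTower.of_algebraMap_eq fun c => ((coordinateRingMap n).commutes c).symm
  have _ : FaithfulSMul R (MvPolynomial (Fin n ⊕ Fin n) ℂ) :=
    (faithfulSMul_iff_algebraMap_injective _ _).2 hinj
  have hgen : ∀ i j, IsAlgebraic R (genericDiagonalAddRankOne n i j) := fun i j => by
    rw [← coordinateRingMap_mk_X i j]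
    exact isAlgebraic_algebraMap (A := MvPolynomial (Fin n ⊕ Fin n) ℂ)
      (Ideal.Quotient.mk _ (MvPolynomial.X (i, j)) : R)
  have hy : ∀ i : Fin n,
      IsAlgebraic R (MvPolynomial.X (Sum.inr i) : MvPolynomial (Fin n ⊕ Fin n) ℂ) := by
    intro i
    obtain ⟨j, hj⟩ : ∃ j, j ∉ ({i} : Finset (Fin n)) := by
      by_contra! hcon
      have := Finset.card_le_card (fun x _ => hcon x : Finset.univ ⊆ ({i} : Finset (Fin n)))
      rw [Finset.card_univ, Fintype.card_fin, Finset.card_singleton] at this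
      omega
    obtain ⟨k, hk⟩ : ∃ k, k ∉ ({i, j} : Finset (Fin n)) := by
      by_contra! hcon
      have := Finset.card_le_card (fun x _ => hcon x : Finset.univ ⊆ ({i, j} : Finset (Fin n)))
      rw [Finset.card_univ, Fintype.card_fin] at this
      have := Finset.card_le_two (a := i) (b := j)
      omega
    simp only [Finset.mem_insert, Finset.mem_singleton, not_or] at hj hk
    -- Uses `(y_j y_k) y_i² = (y_i y_j)(y_i y_k)`, whose products are off-diagonal entries.
    refine IsAlgebraic.of_pow (n := 2) (by norm_num) ?_
    refine IsAlgebraic.of_mul (y := genericDiagonalAddRankOne n j k)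
      (mem_nonZeroDivisors_of_ne_zero ?_) (hgen j k) ?_
    · rw [genericDiagonalAddRankOne_apply_of_ne (Ne.symm hk.2)]
      exact mul_ne_zero (MvPolynomial.X_ne_zero _) (MvPolynomial.X_ne_zero _)
    · have : genericDiagonalAddRankOne n j k * MvPolynomial.X (Sum.inr i) ^ 2 =
          genericDiagonalAddRankOne n i j * genericDiagonalAddRankOne n i k := by
        rw [genericDiagonalAddRankOne_apply_of_ne (Ne.symm hk.2),
          genericDiagonalAddRankOne_apply_of_ne (Ne.symm hj),
          genericDiagonalAddRankOne_apply_of_ne (Ne.symm hk.1)]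
        ring
      rw [this]
      exact (hgen i j).mul (hgen i k)
  have _ : Algebra.IsAlgebraic R (MvPolynomial (Fin n ⊕ Fin n) ℂ) := by
    refine isAlgebraic_of_forall_isAlgebraic_X ?_
    rintro (i | i)
    · have : (MvPolynomial.X (Sum.inl i) : MvPolynomial (Fin n ⊕ Fin n) ℂ) =
          genericDiagonalAddRankOne n i i -
            MvPolynomial.X (Sum.inr i) * MvPolynomial.X (Sum.inr i) := by
        simp [genericDiagonalAddRankOne, Matrix.vecMulVec_apply]
      rw [this]
      exact (hgen i i).sub ((hy i).mul (hy i))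
    · exact hy i
  have _ : Algebra.IsAlgebraic R (FractionRing R) := 
    IsLocalization.isAlgebraic (FractionRing R) (nonZeroDivisors R)
  have h1 := trdeg_add_eq ℂ R (A := MvPolynomial (Fin n ⊕ Fin n) ℂ)
  have h2 := trdeg_add_eq ℂ R (A := FractionRing R)
  rw [trdeg_eq_zero (R := R), add_zero] at h1 h2
  rw [varietyDim, ← h2, h1, MvPolynomial.trdeg_of_isDomain]
  simp [two_mul]

/-! ### Principal minors as row selections, and the tensor action -/

/-- The matrix whose `i`-th row is that of `N` if `I i = 1`, and that of `M` otherwise. -/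
def selectRows {n : ℕ} (M N : Matrix (Fin n) (Fin n) ℂ) (I : Fin n → Fin 2) :
    Matrix (Fin n) (Fin n) ℂ :=
  fun i => if I i = 1 then N i else M i

theorem selectRows_mul {n : ℕ} (M N C : Matrix (Fin n) (Fin n) ℂ) (I : Fin n → Fin 2) :
    selectRows (M * C) (N * C) I = selectRows M N I * C := by
  ext i j
  by_cases h : I i = 1 <;> simp [selectRows, Matrix.mul_apply, h]

/-- Rows outside the support are rows of the identity, so the matrix is block triangular with an
identity block. -/
theorem minor_multiSupport {n : ℕ} (A : Matrix (Fin n) (Fin n) ℂ) (I : Fin n → Fin 2) :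
    minor A (multiSupport I) (multiSupport I) rfl = (selectRows 1 A I).det := by
  have hmem : ∀ i, i ∈ multiSupport I ↔ I i = 1 := fun i => by simp [multiSupport]
  rw [Matrix.twoBlockTriangular_det _ (fun i => i ∈ multiSupport I)]
  · have h1 : Matrix.toSquareBlockProp (selectRows 1 A I) (fun i => ¬ i ∈ multiSupport I) = 1 := by
      ext ⟨i, hi⟩ ⟨j, hj⟩
      rw [hmem] at hi
      simp [Matrix.toSquareBlockProp, selectRows, hi, Matrix.one_apply]
    rw [h1, Matrix.det_one, mul_one, minor]
    refine Eq.trans ?_ ((Matrix.det_submatrix_equiv_self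
      ((multiSupport I).orderIsoOfFin rfl).toEquiv (Matrix.toSquareBlockProp
        (selectRows 1 A I) fun i => i ∈ multiSupport I)).trans ?_)
    on_goal 2 => congr!
    congr 1
    ext i j
    have hi := (hmem _).1 ((multiSupport I).orderEmbOfFin_mem rfl i)
    simp [Matrix.toSquareBlockProp, selectRows, hi]
  · intro i hi j hj
    rw [hmem] at hi
    have : i ≠ j := by rintro rfl; exact hi ((hmem _).1 hj)
    simp [selectRows, hi, this]

theorem principalMinorVector_one {n : ℕ} (A : Matrix (Fin n) (Fin n) ℂ) (I : Fin n → Fin 2) :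
    principalMinorVector A 1 I = (selectRows 1 A I).det := by
  rw [principalMinorVector, one_pow, one_mul, minor_multiSupport]

theorem sum_prod_mul_det_selectRows {n : ℕ} (c : Fin n → Fin 2 → ℂ)
    (M N : Matrix (Fin n) (Fin n) ℂ) :
    ∑ J : Fin n → Fin 2, (∏ i, c i (J i)) * (selectRows M N J).det =
      Matrix.det (fun i => c i 0 • M i + c i 1 • N i) := by
  have h := (Matrix.detRowAlternating (n := Fin n) (R := ℂ)).toMultilinearMap.map_sum
    (α := fun _ => Fin 2) fun i s => c i s • (if s = 1 then N i else M i)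
  simp only [Fin.sum_univ_two, Fin.zero_eq_one_iff, OfNat.ofNat_ne_one, if_false, if_true] at h
  refine Eq.trans ?_ h.symm
  refine Finset.sum_congr rfl fun J _ => ?_
  rw [MultilinearMap.map_smul_univ]
  rfl

theorem segreBlock_mul_apply {n : ℕ} (g : SegreGroup n) (r s : Fin 2)
    (A : Matrix (Fin n) (Fin n) ℂ) (i j : Fin n) :
    (segreBlock g r s * A) i j = (g.left i).1 r s * A (g.right⁻¹ i) j := by
  rw [Matrix.mul_apply, Finset.sum_eq_single (g.right⁻¹ i)]
  · simp [segreBlock]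
  · intro k _ hk
    have : ¬ i = g.right k := fun hc => hk (by rw [hc]; simp)
    simp [segreBlock, this]
  · simp

theorem segreBlock_eq_mul_one {n : ℕ} (g : SegreGroup n) (r s : Fin 2) :
    segreBlock g r s = segreBlock g r s * 1 := (Matrix.mul_one _).symm

theorem tensorAction_principalMinorVector {n : ℕ} (g : SegreGroup n)
    {A B : Matrix (Fin n) (Fin n) ℂ}
    (h : segreBlock g 1 0 + segreBlock g 1 1 * A =
      B * (segreBlock g 0 0 + segreBlock g 0 1 * A)) :
    tensorAction n g (principalMinorVector A 1) =
      ((Equiv.Perm.sign g.right⁻¹ : ℤ) *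
        (segreBlock g 0 0 + segreBlock g 0 1 * A).det : ℂ) • principalMinorVector B 1 := by
  funext I
  set E : Matrix (Fin n) (Fin n) ℂ := (1 : Matrix (Fin n) (Fin n) ℂ).submatrix (⇑g.right⁻¹) id with hE
  set F : Matrix (Fin n) (Fin n) ℂ := A.submatrix (⇑g.right⁻¹) id with hF
  -- Permuting tensor factors permutes the selected rows; the resulting sign disappears
  -- projectively.
  have hperm : ∀ J : Fin n → Fin 2, (selectRows 1 A (J ∘ g.right)).det =
      (Equiv.Perm.sign g.right⁻¹ : ℤ) * (selectRows E F J).det := by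
    intro J
    have : selectRows E F J = (selectRows 1 A (J ∘ g.right)).submatrix (⇑g.right⁻¹) id := by
      ext i j
      by_cases hJ : J i = 1 <;> simp [selectRows, hE, hF, hJ]
    rw [this, Matrix.det_permute, ← mul_assoc]
    rcases Int.units_eq_one_or (Equiv.Perm.sign g.right⁻¹) with hs | hs <;> rw [hs] <;> simp
  have hrow : ∀ r i, (segreBlock g r 0 + segreBlock g r 1 * A) i =
      (g.left i).1 r 0 • E i + (g.left i).1 r 1 • F i := by
    intro r i
    funext j
    rw [segreBlock_eq_mul_one g r 0, Matrix.add_apply, segreBlock_mul_apply, segreBlock_mul_apply]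
    rfl
  have hsel : (fun i => (g.left i).1 (I i) 0 • E i + (g.left i).1 (I i) 1 • F i :
      Matrix (Fin n) (Fin n) ℂ) = selectRows (segreBlock g 0 0 + segreBlock g 0 1 * A)
        (segreBlock g 1 0 + segreBlock g 1 1 * A) I := by
    funext i
    rw [← hrow, selectRows]
    split_ifs with hI
    · rw [hI]
    · rw [show I i = 0 by omega]
  change ∑ J : Fin n → Fin 2, (∏ i, (g.left i).1 (I i) (J i)) *
    principalMinorVector A 1 (J ∘ g.right) = _
  simp only [principalMinorVector_one, hperm, Pi.smul_apply, smul_eq_mul]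
  simp only [mul_left_comm _ (((Equiv.Perm.sign g.right⁻¹ : ℤ) : ℂ)), ← Finset.mul_sum]
  rw [sum_prod_mul_det_selectRows (fun i s => (g.left i).1 (I i) s), hsel, h]
  -- The stacked matrix is now `[M; B * M] = [1; B] * M`, so `det M` factors out of every
  -- coordinate.
  conv_lhs => rw [← Matrix.one_mul (segreBlock g 0 0 + segreBlock g 0 1 * A), ← Matrix.mul_assoc,
    selectRows_mul, Matrix.mul_one, Matrix.det_mul]
  ring

theorem principalMinorMap_eq_smul {n : ℕ} (g : SegreGroup n) {A B : Matrix (Fin n) (Fin n) ℂ}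
    (h : segreBlock g 1 0 + segreBlock g 1 1 * A =
      B * (segreBlock g 0 0 + segreBlock g 0 1 * A)) :
    principalMinorMap B 1 one_ne_zero =
      tensorActionGL n g • principalMinorMap A 1 one_ne_zero := by
  rw [principalMinorMap, principalMinorMap, Projectivization.smul_mk, eq_comm,
    Projectivization.mk_eq_mk_iff']
  exact ⟨_, (tensorAction_principalMinorVector g h).symm⟩

/-! ### Symplectic relations and injectivity of `ι` -/

theorem segreBlock_transpose_mul {n : ℕ} (g : SegreGroup n) (r s r' s' : Fin 2) :
    (segreBlock g r s)ᵀ * segreBlock g r' s' = Matrix.diagonal fun j =>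
      (g.left (g.right j)).1 r s * (g.left (g.right j)).1 r' s' := by
  ext j k
  rw [Matrix.mul_apply, Finset.sum_eq_single (g.right j)]
  · by_cases hjk : j = k
    · subst hjk; simp [segreBlock]
    · simp [segreBlock, hjk]
  · intro i _ hi
    simp [segreBlock, hi]
  · simp

/-- With `M = P + QA`, the relations `PᵀS = 1 + RᵀQ`, `PᵀR = RᵀP` and `QᵀS = SᵀQ` give `Mᵀ B M = Mᵀ
Bᵀ M`; then `M` cancels. -/
theorem isSymm_of_segreBlock {n : ℕ} (g : SegreGroup n) {A B : Matrix (Fin n) (Fin n) ℂ}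
    (hA : A.IsSymm) (hu : IsUnit (segreBlock g 0 0 + segreBlock g 0 1 * A))
    (h : segreBlock g 1 0 + segreBlock g 1 1 * A =
      B * (segreBlock g 0 0 + segreBlock g 0 1 * A)) : B.IsSymm := by
  set M := segreBlock g 0 0 + segreBlock g 0 1 * A with hM
  have hdet : ∀ i, (g.left i).1 0 0 * (g.left i).1 1 1 - (g.left i).1 0 1 * (g.left i).1 1 0 = 1 :=
    fun i => by rw [← Matrix.det_fin_two]; exact (g.left i).2
  have hone : (segreBlock g 0 0)ᵀ * segreBlock g 1 1 =
      1 + (segreBlock g 1 0)ᵀ * segreBlock g 0 1 := by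
    rw [segreBlock_transpose_mul, segreBlock_transpose_mul, ← Matrix.diagonal_one,
      Matrix.diagonal_add]
    congr 1
    funext j
    linear_combination hdet (g.right j)
  have hone' : (segreBlock g 1 1)ᵀ * segreBlock g 0 0 =
      1 + (segreBlock g 0 1)ᵀ * segreBlock g 1 0 := by
    have := congrArg Matrix.transpose hone
    simpa using this
  have hcomm : ∀ s, (segreBlock g 0 s)ᵀ * segreBlock g 1 s =
      (segreBlock g 1 s)ᵀ * segreBlock g 0 s := by
    intro s
    rw [segreBlock_transpose_mul, segreBlock_transpose_mul]
    simp only [mul_comm]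
  have hsymm : Mᵀ * B * M = Mᵀ * Bᵀ * M := by
    have h1 : Mᵀ * B * M = Mᵀ * (segreBlock g 1 0 + segreBlock g 1 1 * A) := by
      rw [h, Matrix.mul_assoc]
    have h2 : Mᵀ * Bᵀ * M = (segreBlock g 1 0 + segreBlock g 1 1 * A)ᵀ * M := by
      rw [h, Matrix.transpose_mul]
    rw [h1, h2, hM]
    simp only [Matrix.transpose_add, Matrix.transpose_mul, hA.eq, Matrix.add_mul, Matrix.mul_add,
      Matrix.mul_assoc]
    simp only [← Matrix.mul_assoc _ _ A, hone, hone', hcomm, Matrix.add_mul, Matrix.mul_add,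
      Matrix.one_mul, Matrix.mul_one]
    abel
  obtain ⟨u, hu'⟩ := hu
  have ht : IsUnit Mᵀ := by
    rw [Matrix.isUnit_iff_isUnit_det, Matrix.det_transpose, ← Matrix.isUnit_iff_isUnit_det]
    exact ⟨u, hu'⟩
  have hM' : IsUnit M := ⟨u, hu'⟩
  exact (ht.mul_left_cancel (hM'.mul_right_cancel hsymm)).symm

theorem segreToSymplectic_injective (n : ℕ) : Function.Injective (segreToSymplectic n) := by
  intro g h hgh
  have hm : segreMatrix g = segreMatrix h := congrArg Subtype.val hgh
  obtain ⟨h00, h01, h10, h11⟩ := Matrix.fromBlocks_inj.1 hm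
  have hb : ∀ r s, segreBlock g r s = segreBlock h r s := by
    intro r s
    fin_cases r <;> fin_cases s <;> assumption
  have hright : g.right = h.right := by
    ext1 j
    by_contra hne
    -- Where the permutations differ, `h` has a zero entry in all four blocks, which would make a
    -- factor of `g` zero despite determinant one.
    have h0 : ∀ r s, (g.left (g.right j)).1 r s = 0 := by
      intro r s
      have := congrFun (congrFun (hb r s) (g.right j)) j
      simpa [segreBlock, hne] using this
    have := (g.left (g.right j)).2
    rw [Matrix.det_fin_two, h0, h0, h0] at this
    simp at this
  refine SemidirectProduct.ext (funext fun i => Subtype.ext ?_) hright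
  ext r s
  have := congrFun (congrFun (hb r s) i) (g.right⁻¹ i)
  simpa [segreBlock, ← hright] using this

/-! ### Reduction to `t = 1` and irreducibility of `φ(X)` -/

theorem smul_mem_exclusiveRankLEOne {n : ℕ} {A : Matrix (Fin n) (Fin n) ℂ}
    (hA : A ∈ exclusiveRankLEOne n) (c : ℂ) : c • A ∈ exclusiveRankLEOne n := by
  refine ⟨hA.1.smul c, (exclusiveRank_le_one_iff _).2 fun i k j l h1 h2 h3 h4 => ?_⟩
  have := (exclusiveRank_le_one_iff A).1 hA.2 i k j l h1 h2 h3 h4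
  simp only [Matrix.smul_apply, smul_eq_mul]
  linear_combination c ^ 2 * this

theorem principalMinorMap_eq_one {n : ℕ} (A : Matrix (Fin n) (Fin n) ℂ) (t : ℂ) (ht : t ≠ 0) :
    principalMinorMap A t ht = principalMinorMap (t⁻¹ • A) 1 one_ne_zero := by
  rw [principalMinorMap, principalMinorMap, Projectivization.mk_eq_mk_iff']
  refine ⟨t ^ n, funext fun I => ?_⟩
  have hle : (multiSupport I).card ≤ n := by simpa using (multiSupport I).card_le_univ
  simp only [Pi.smul_apply, smul_eq_mul, principalMinorVector, one_pow, one_mul, minor,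
    Matrix.submatrix_smul, Matrix.det_smul, Fintype.card_fin]
  rw [← mul_assoc, inv_pow, ← div_eq_mul_inv, pow_sub₀ _ ht hle, div_eq_mul_inv]

/-- The map `φ([A, 1])` on points of affine space. -/
noncomputable def affinePrincipalMinorMap (n : ℕ) (z : Fin n × Fin n → ℂ) : ℙ ℂ (TensorSpace n) :=
  principalMinorMap (fun i j => z (i, j)) 1 one_ne_zero

theorem continuous_affinePrincipalMinorMap (n : ℕ) :
    @Continuous _ _ (affineZariski (Fin n × Fin n)) (projectiveZariski (Fin n → Fin 2))
      (affinePrincipalMinorMap n) := by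
  refine continuous_affineZariski_mk
    (v := fun z => principalMinorVector (fun i j => z (i, j)) 1) _
    (fun I => Matrix.det (Matrix.submatrix
      (fun i j => MvPolynomial.X (i, j) : Matrix (Fin n) (Fin n) (MvPolynomial (Fin n × Fin n) ℂ))
      ((multiSupport I).orderEmbOfFin rfl) ((multiSupport I).orderEmbOfFin rfl))) fun z I => ?_
  change 1 ^ _ * Matrix.det _ = _
  rw [one_pow, one_mul, RingHom.map_det]
  congr 1
  ext i j
  change _ = MvPolynomial.eval z (MvPolynomial.X (_, _))
  rw [MvPolynomial.eval_X]
  rfl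

theorem setOf_principalMinorMap_eq (n : ℕ) :
    {p | ∃ A ∈ exclusiveRankLEOne n, ∃ (t : ℂ) (ht : t ≠ 0), p = principalMinorMap A t ht} =
      affinePrincipalMinorMap n '' (matrixPoint '' exclusiveRankLEOne n) := by
  ext p
  constructor
  · rintro ⟨A, hA, t, ht, rfl⟩
    exact ⟨_, ⟨_, smul_mem_exclusiveRankLEOne hA t⁻¹, rfl⟩, (principalMinorMap_eq_one A t ht).symm⟩
  · rintro ⟨_, ⟨A, hA, rfl⟩, rfl⟩
    exact ⟨A, hA, 1, one_ne_zero, rfl⟩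

theorem isIrreducible_principalMinorImage (n : ℕ) :
    @IsIrreducible _ (projectiveZariski (Fin n → Fin 2))
      (principalMinorImage (exclusiveRankLEOne n)) := by
  let _ := affineZariski (Fin n × Fin n)
  let _ := projectiveZariski (Fin n → Fin 2)
  rw [principalMinorImage, setOf_principalMinorMap_eq]
  exact ((isIrreducible_exclusiveRankLEOne n).image _
    (continuous_affinePrincipalMinorMap n).continuousOn).closure

/-! ### Invariance of `φ(X)` -/

/-- The diagonal part `D` moves to `diag(e)` by a Möbius transformation in each coordinate.
Subtracting its equation leaves `(B - diag(e)) M` of rank at most one, and `M` is invertible. -/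
theorem mem_exclusiveRankLEOne_of_segreBlock {n : ℕ} (g : SegreGroup n)
    (x : Fin n ⊕ Fin n → ℂ) {B : Matrix (Fin n) (Fin n) ℂ}
    (hx : ∀ i, (g.left i).1 0 0 + (g.left i).1 0 1 * x (Sum.inl (g.right⁻¹ i)) ≠ 0)
    (hu : IsUnit (segreBlock g 0 0 + segreBlock g 0 1 * diagonalAddRankOne x))
    (h : segreBlock g 1 0 + segreBlock g 1 1 * diagonalAddRankOne x =
      B * (segreBlock g 0 0 + segreBlock g 0 1 * diagonalAddRankOne x)) :
    B ∈ exclusiveRankLEOne n := by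
  have hs := isSymm_of_segreBlock g (isSymm_diagonalAddRankOne x) hu h
  set M := segreBlock g 0 0 + segreBlock g 0 1 * diagonalAddRankOne x with hM
  set D := Matrix.diagonal (x ∘ Sum.inl) with hD
  set y := x ∘ Sum.inr with hy
  set e : Fin n → ℂ := fun i =>
    ((g.left i).1 1 0 + (g.left i).1 1 1 * x (Sum.inl (g.right⁻¹ i))) /
      ((g.left i).1 0 0 + (g.left i).1 0 1 * x (Sum.inl (g.right⁻¹ i))) with he
  have hdiag : segreBlock g 1 0 + segreBlock g 1 1 * D =
      Matrix.diagonal e * (segreBlock g 0 0 + segreBlock g 0 1 * D) := by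
    ext i j
    rw [Matrix.diagonal_mul, Matrix.add_apply, Matrix.add_apply, segreBlock_mul_apply,
      segreBlock_mul_apply]
    by_cases hij : i = g.right j
    · subst hij
      have hinv : g.right⁻¹ (g.right j) = j := g.right.symm_apply_apply j
      have hxj := hx (g.right j)
      have hej : e (g.right j) * ((g.left (g.right j)).1 0 0 +
          (g.left (g.right j)).1 0 1 * x (Sum.inl (g.right⁻¹ (g.right j)))) =
          (g.left (g.right j)).1 1 0 +
            (g.left (g.right j)).1 1 1 * x (Sum.inl (g.right⁻¹ (g.right j))) :=
        div_mul_cancel₀ _ hxj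
      rw [hinv] at hej ⊢
      rw [hD, Matrix.diagonal_apply_eq, segreBlock, segreBlock, if_pos rfl, if_pos rfl]
      exact hej.symm
    · have hne : g.right⁻¹ i ≠ j := fun hc => hij (by rw [← hc]; simp)
      rw [hD, Matrix.diagonal_apply_ne _ hne, segreBlock, segreBlock, if_neg hij, if_neg hij]
      ring
  have hrank : (B - Matrix.diagonal e) * M = Matrix.vecMulVec
      ((segreBlock g 1 1 - Matrix.diagonal e * segreBlock g 0 1) *ᵥ y) y := by
    rw [← Matrix.mul_vecMulVec, Matrix.sub_mul, ← h, hM]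
    have hA : diagonalAddRankOne x = D + Matrix.vecMulVec y y := rfl
    simp only [hA, Matrix.mul_add, Matrix.sub_mul, Matrix.mul_assoc] at hdiag ⊢
    rw [← add_assoc, hdiag]
    abel
  have hB : B - Matrix.diagonal e = Matrix.vecMulVec
      ((segreBlock g 1 1 - Matrix.diagonal e * segreBlock g 0 1) *ᵥ y) (y ᵥ* M⁻¹) := by
    rw [← Matrix.vecMulVec_mul, ← hrank, Matrix.mul_assoc,
      Matrix.mul_nonsing_inv _ ((Matrix.isUnit_iff_isUnit_det _).1 hu), Matrix.mul_one]
  refine mem_exclusiveRankLEOne_of_eq_mul hs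
    (w := (segreBlock g 1 1 - Matrix.diagonal e * segreBlock g 0 1) *ᵥ y) (z := y ᵥ* M⁻¹)
    fun i j hij => ?_
  have := congrFun (congrFun hB i) j
  rwa [Matrix.sub_apply, Matrix.diagonal_apply_ne _ hij, sub_zero, Matrix.vecMulVec_apply] at this

theorem exists_polynomial_eval_ne_zero_imp {n : ℕ} (g : SegreGroup n) :
    ∃ h : MvPolynomial (Fin n ⊕ Fin n) ℂ, h ≠ 0 ∧ ∀ x, MvPolynomial.eval x h ≠ 0 →
      (∀ i, (g.left i).1 0 0 + (g.left i).1 0 1 * x (Sum.inl (g.right⁻¹ i)) ≠ 0) ∧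
        IsUnit (segreBlock g 0 0 + segreBlock g 0 1 * diagonalAddRankOne x) := by
  set h1 : MvPolynomial (Fin n ⊕ Fin n) ℂ := ∏ i, (MvPolynomial.C ((g.left i).1 0 0) +
    MvPolynomial.C ((g.left i).1 0 1) * MvPolynomial.X (Sum.inl (g.right⁻¹ i))) with hh1
  set h2 : MvPolynomial (Fin n ⊕ Fin n) ℂ := Matrix.det
    ((segreBlock g 0 0).map MvPolynomial.C +
      (segreBlock g 0 1).map MvPolynomial.C * genericDiagonalAddRankOne n) with hh2
  have e1 : ∀ x, MvPolynomial.eval x h1 =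
      ∏ i, ((g.left i).1 0 0 + (g.left i).1 0 1 * x (Sum.inl (g.right⁻¹ i))) := by
    intro x
    simp [hh1, map_prod]
  have e2 : ∀ x, MvPolynomial.eval x h2 =
      (segreBlock g 0 0 + segreBlock g 0 1 * diagonalAddRankOne x).det := by
    intro x
    have hC : ∀ N : Matrix (Fin n) (Fin n) ℂ,
        (N.map MvPolynomial.C).map (MvPolynomial.eval x) = N := by
      intro N; ext i j; simp
    rw [hh2, RingHom.map_det, map_add, map_mul]
    simp only [RingHom.mapMatrix_apply, hC, map_eval_genericDiagonalAddRankOne]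
  refine ⟨h1 * h2, ?_, fun x hx => ?_⟩
  · intro h0
    -- Nonvanishing is tested at `y = 0`. This `d` makes `a_i + b_i d` equal to `a_i`, or to `b_i`
    -- when `a_i = 0`; determinant one excludes that both vanish.
    set d : Fin n → ℂ := fun j => if (g.left (g.right j)).1 0 0 = 0 then 1 else 0 with hd
    set u : Fin n → ℂ := fun i =>
      (g.left i).1 0 0 + (g.left i).1 0 1 * d (g.right⁻¹ i) with hu
    have hu0 : ∀ i, u i ≠ 0 := by
      intro i
      have hinv : g.right (g.right⁻¹ i) = i := g.right.apply_symm_apply i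
      simp only [hu, hd, hinv]
      split_ifs with ha
      · intro hb
        have hdet := (g.left i).2
        rw [Matrix.det_fin_two] at hdet
        refine one_ne_zero (α := ℂ) ?_
        linear_combination -hdet + (g.left i).1 1 1 * ha + (g.left i).1 1 0 * (ha - hb)
      · simpa using ha
    have hev := congrArg (MvPolynomial.eval (Sum.elim d 0)) h0
    rw [map_mul, map_zero, e1, e2] at hev
    have hM : segreBlock g 0 0 + segreBlock g 0 1 * diagonalAddRankOne (Sum.elim d 0) =
        (Matrix.diagonal u).submatrix id g.right := by
      have hA : diagonalAddRankOne (Sum.elim d 0) = Matrix.diagonal d := by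
        ext i j; simp [diagonalAddRankOne]
      ext i j
      rw [Matrix.add_apply, segreBlock_mul_apply, hA, Matrix.submatrix_apply]
      by_cases hij : i = g.right j
      · subst hij; simp [segreBlock, hu]
      · have hne : g.right⁻¹ i ≠ j := fun hc => hij (by rw [← hc]; simp)
        rw [Matrix.diagonal_apply_ne _ hne]
        simp [segreBlock, hij]
    rw [hM, Matrix.det_permute', Matrix.det_diagonal] at hev
    have hprod : ∏ i, u i ≠ 0 := Finset.prod_ne_zero_iff.2 fun i _ => hu0 i
    refine mul_ne_zero (a := ∏ i, u i) hprod (mul_ne_zero ?_ hprod) hev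
    exact_mod_cast (Equiv.Perm.sign g.right).ne_zero
  · rw [map_mul, e1, e2] at hx
    exact ⟨fun i => Finset.prod_ne_zero_iff.1 (left_ne_zero_of_mul hx) i (Finset.mem_univ i),
      (Matrix.isUnit_iff_isUnit_det _).2 (right_ne_zero_of_mul hx).isUnit⟩

/-- The condition on `z` is closed and holds at generic parameters `(d, y)`, hence at all
parameters, hence on the closure `X`. -/
theorem tensorActionGL_smul_affinePrincipalMinorMap_mem {n : ℕ} (g : SegreGroup n)
    {z : Fin n × Fin n → ℂ} (hz : z ∈ matrixPoint '' exclusiveRankLEOne n) :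
    tensorActionGL n g • affinePrincipalMinorMap n z ∈
      principalMinorImage (exclusiveRankLEOne n) := by
  let τ₁ := affineZariski (Fin n ⊕ Fin n)
  let τ₂ := affineZariski (Fin n × Fin n)
  let τ₃ := projectiveZariski (Fin n → Fin 2)
  have hcl : IsClosed {z | tensorActionGL n g • affinePrincipalMinorMap n z ∈
      principalMinorImage (exclusiveRankLEOne n)} :=
    IsClosed.preimage ((continuous_projectiveZariski_smul (tensorActionGL n g)).comp
      (continuous_affinePrincipalMinorMap n)) isClosed_closure
  rw [exclusiveRankLEOne_eq_closure] at hz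
  refine closure_minimal ?_ hcl hz
  obtain ⟨h, h0, hh⟩ := exists_polynomial_eval_ne_zero_imp g
  have huniv := eq_univ_of_isClosed_affineZariski
    (hcl.preimage (continuous_matrixPoint_diagonalAddRankOne n)) h0 fun x hx => by
      obtain ⟨hx1, hx2⟩ := hh x hx
      have hB : segreBlock g 1 0 + segreBlock g 1 1 * diagonalAddRankOne x =
          (segreBlock g 1 0 + segreBlock g 1 1 * diagonalAddRankOne x) *
            (segreBlock g 0 0 + segreBlock g 0 1 * diagonalAddRankOne x)⁻¹ *
            (segreBlock g 0 0 + segreBlock g 0 1 * diagonalAddRankOne x) := by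
        rw [Matrix.mul_assoc,
          Matrix.nonsing_inv_mul _ ((Matrix.isUnit_iff_isUnit_det _).1 hx2), Matrix.mul_one]
      refine subset_closure ⟨_, mem_exclusiveRankLEOne_of_segreBlock g x hx1 hx2 hB, 1,
        one_ne_zero, ?_⟩
      exact (principalMinorMap_eq_smul g hB).symm
  rintro _ ⟨x, rfl⟩
  exact Set.eq_univ_iff_forall.1 huniv x

theorem tensorActionGL_smul_mem_principalMinorImage {n : ℕ} (g : SegreGroup n)
    {p : ℙ ℂ (TensorSpace n)} (hp : p ∈ principalMinorImage (exclusiveRankLEOne n)) :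
    tensorActionGL n g • p ∈ principalMinorImage (exclusiveRankLEOne n) := by
  let τ := projectiveZariski (Fin n → Fin 2)
  have hcl : IsClosed ((fun p => tensorActionGL n g • p) ⁻¹'
      principalMinorImage (exclusiveRankLEOne n)) :=
    IsClosed.preimage (continuous_projectiveZariski_smul (tensorActionGL n g)) isClosed_closure
  refine closure_minimal ?_ hcl hp
  rw [setOf_principalMinorMap_eq]
  rintro _ ⟨z, hz, rfl⟩
  exact tensorActionGL_smul_affinePrincipalMinorMap_mem g hz

theorem image_smul_principalMinorImage {n : ℕ} (g : SegreGroup n) :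
    (fun p => tensorActionGL n g • p) '' principalMinorImage (exclusiveRankLEOne n) =
      principalMinorImage (exclusiveRankLEOne n) := by
  refine Set.Subset.antisymm ?_ fun p hp => ?_
  · rintro _ ⟨p, hp, rfl⟩
    exact tensorActionGL_smul_mem_principalMinorImage g hp
  · refine ⟨tensorActionGL n g⁻¹ • p, tensorActionGL_smul_mem_principalMinorImage g⁻¹ hp, ?_⟩
    simp only [map_inv, smul_inv_smul]

theorem mainTheorem3 (n : ℕ) :
    -- `X` is an irreducible variety, of dimension `2n` as soon as `n ≥ 3`
    IsClosed[affineZariski (Fin n × Fin n)] (matrixPoint '' exclusiveRankLEOne n) ∧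
    @IsIrreducible _ (affineZariski (Fin n × Fin n)) (matrixPoint '' exclusiveRankLEOne n) ∧
    (3 ≤ n → varietyDim (matrixPoint '' exclusiveRankLEOne n) = ((2 * n : ℕ) : Cardinal)) ∧
    -- `X` is parametrized by diagonal matrices plus rank-one symmetric matrices
    matrixPoint '' exclusiveRankLEOne n =
      closure[affineZariski (Fin n × Fin n)] (Set.range fun p : (Fin n → ℂ) × (Fin n → ℂ) =>
        matrixPoint (Matrix.diagonal p.1 + Matrix.vecMulVec p.2 p.2)) ∧
    -- the group is a subgroup of `Sp(2n)`
    Function.Injective (segreToSymplectic n) ∧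
    -- its action on tensors is the one induced by the action of `Sp(2n)` on Lagrangian
    -- subspaces: `g` maps the graph of `A` to the graph of `B`
    (∀ (g : SegreGroup n) (A B : Matrix (Fin n) (Fin n) ℂ), A.IsSymm →
      IsUnit (segreBlock g 0 0 + segreBlock g 0 1 * A) →
      segreBlock g 1 0 + segreBlock g 1 1 * A = B * (segreBlock g 0 0 + segreBlock g 0 1 * A) →
      B.IsSymm ∧ principalMinorMap B 1 one_ne_zero =
        tensorActionGL n g • principalMinorMap A 1 one_ne_zero) ∧
    -- `φ(X)` is an irreducible variety, invariant under the group
    IsClosed[projectiveZariski (Fin n → Fin 2)] (principalMinorImage (exclusiveRankLEOne n)) ∧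
    @IsIrreducible _ (projectiveZariski (Fin n → Fin 2))
      (principalMinorImage (exclusiveRankLEOne n)) ∧
    ∀ g : SegreGroup n, (fun p => tensorActionGL n g • p) ''
      principalMinorImage (exclusiveRankLEOne n) = principalMinorImage (exclusiveRankLEOne n) := by
  refine ⟨isClosed_exclusiveRankLEOne n, isIrreducible_exclusiveRankLEOne n,
    varietyDim_exclusiveRankLEOne, ?_, segreToSymplectic_injective n,
    fun g A B hA hu h => ⟨isSymm_of_segreBlock g hA hu h, principalMinorMap_eq_smul g h⟩,
    @isClosed_closure _ (projectiveZariski (Fin n → Fin 2)) _,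
    isIrreducible_principalMinorImage n, image_smul_principalMinorImage⟩
  rw [range_diagonalAddRankOne, exclusiveRankLEOne_eq_closure]
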